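/- Let $Cl_n$ be the Clifford geometric algebra of Euclidean $\mathbb R^n$ (so $v^2=|v|^2$ for vectors), with reverse $\widetilde M$, outer product $\wedge$, grade parts $\langle M\rangle_k$ and modulus $|M|=\sqrt{\langle M\widetilde M\rangle_0}$. Let $r\ge 1$ and let $A,B\in Cl_n$ be $r$-blades, i.e. outer products of $r$ linearly independent vectors, representing the $r$-dimensional subspaces $\mathsf A=\{x\in\mathbb R^n: x\wedge A=0\}$ and $\mathsf B=\{x\in\mathbb R^n: x\wedge B=0\}$. 1. (Reshaping.) There are nonzero vectors $a_1,\dots,a_r$ and $b_1,\dots,b_r$ with $A=a_1a_2\cdots a_r$, $B=b_1b_2\cdots b_r$ and $a_j\perp a_k$, $b_j\perp b_k$, $a_j\perp b_k$ for all $j\ne k$. They can be chosen so that the angles $\theta_k=\angle(a_k,b_k)$ satisfy $\theta_k\le\pi/2$ for all $k\neq 1$, and, if $\langle A\widetilde B\rangle_0\ge 0$, also $\theta_1\le\pi/2$. 2. For all such $a_k,b_k$, set $\theta_k=\angle(a_k,b_k)\in[0,\pi]$, $c_k=\cos\theta_k$, $s_k=\sin\theta_k$, and $i_k=\dfrac{a_k\wedge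 b_k}{|a_k||b_k|s_k}$ if $s_k\neq0$, $i_k=0$ if $s_k=0$. Then $\mathsf A=\mathrm{span}\{a_k\}$, $\mathsf B=\mathrm{span}\{b_k\}$, $|A|=\prod_k|a_k|$, $|B|=\prod_k|b_k|$. If $s_k\ne0$, then $i_k$ is a $2$-blade that represents the plane $\mathrm{span}\{a_k,b_k\}$, with $i_k^2=-1$ and $|i_k|=1$. For $j\neq k$, $\mathrm{span}\{a_j,b_j\}\perp\mathrm{span}\{a_k,b_k\}$, $\langle i_j\widetilde{i_k}\rangle_0=0$ and $i_ji_k=i_ki_j$. Moreover $a_kb_k=|a_k||b_k|(c_k+i_ks_k)$ for every $k$, and $$A\widetilde B=a_1a_2\cdots a_r\,b_r\cdots b_2b_1=a_1b_1\,a_2b_2\cdots a_rb_r=|A||B|\prod_{k=1}^r(c_k+i_ks_k)=|A||B|\sum_{S\subseteq\{1,\dots,r\}}\Big(\prod_{k\in S}s_k\prod_{k\notin S}c_k\Big)i_S,\qquad i_S=\prod_{k\in S}i_k .$$ The grade $2m$ part of $A\widetilde B$ is the sum of the terms with $|S|=m$ (times $|A||B|$), and all odd grade parts vanish. In particular $$\frac{\langle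 A\widetilde B\rangle_0}{|A||B|}=\prod_{k=1}^r\cos\theta_k,\qquad \langle A\widetilde B\rangle_2=|A||B|\sum_{k=1}^r s_k\Big(\prod_{j\ne k}c_j\Big)i_k,$$ $$\langle A\widetilde B\rangle_{2r}=|A||B|\,s_1\cdots s_r\,i_1\cdots i_r,\qquad \big|\langle A\widetilde B\rangle_{2r}\big|=|A||B|\prod_{k=1}^r\sin\theta_k .$$ 3. (Principal angles of the subspaces.) $\mathsf A$ and $\mathsf B$ have principal vectors, i.e. orthonormal bases $p_1,\dots,p_r$ of $\mathsf A$ and $q_1,\dots,q_r$ of $\mathsf B$ with $p_j\perp q_k$ for $j\neq k$ and $\varphi_k=\angle(p_k,q_k)\in[0,\pi/2]$. For any such principal vectors, with $i'_k=(p_k\wedge q_k)/\sin\varphi_k$ (and $i'_k=0$ if $\sin\varphi_k=0$), there is a sign $\varepsilon\in\{1,-1\}$ (the relative orientation of $A$ and $B$) such that $$A\widetilde B=\varepsilon|A||B|\prod_{k=1}^r(\cos\varphi_k+i'_k\sin\varphi_k),\qquad \frac{\langle A\widetilde B\rangle_0}{|A||B|}=\varepsilon\prod_{k=1}^r\cos\varphi_k,\qquad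 \big|\langle A\widetilde B\rangle_{2r}\big|=|A||B|\prod_{k=1}^r\sin\varphi_k .$$ -/

import Mathlib

noncomputable section

namespace SubspaceBlades

/-- The Euclidean space `ℝⁿ`. -/
abbrev Vec (n : ℕ) : Type := EuclideanSpace ℝ (Fin n)

/-- The Euclidean quadratic form `x ↦ x · x` on `ℝⁿ`. -/
def euclideanForm (n : ℕ) : QuadraticForm ℝ (Vec n) :=
  LinearMap.BilinMap.toQuadraticMap (innerₗ (Vec n))

/-- The Clifford geometric algebra `Cl_n` of Euclidean `n`-space; its multiplication is the
geometric product, and `CliffordAlgebra.reverse` is the reverse. -/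
abbrev Cl (n : ℕ) : Type := CliffordAlgebra (euclideanForm n)

/-- The inclusion of vectors in `Cl_n`. -/
abbrev vec {n : ℕ} : Vec n →ₗ[ℝ] Cl n := CliffordAlgebra.ι (euclideanForm n)

/-- The canonical linear isomorphism of `Cl_n` with the Grassmann algebra of `ℝⁿ`, which sends
`e_{k₁} e_{k₂} ⋯ e_{k_m}` to `e_{k₁} ∧ e_{k₂} ∧ ⋯ ∧ e_{k_m}` for an orthonormal basis `e` and
`k₁ < ⋯ < k_m`. -/
def toGrassmann (n : ℕ) : Cl n ≃ₗ[ℝ] ExteriorAlgebra ℝ (Vec n) :=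
  CliffordAlgebra.equivExterior (euclideanForm n)

/-- The outer product `M ∧ N` on `Cl_n`. -/
def outer {n : ℕ} (M N : Cl n) : Cl n :=
  (toGrassmann n).symm (toGrassmann n M * toGrassmann n N)

/-- The outer product `v₁ ∧ ⋯ ∧ v_r` of vectors, as an element of `Cl_n`. -/
def outerProd {n r : ℕ} (v : Fin r → Vec n) : Cl n :=
  (toGrassmann n).symm (ExteriorAlgebra.ιMulti ℝ r v)

/-- The grade `k` part `⟨M⟩_k` of a multivector. -/
def gradePart {n : ℕ} (k : ℕ) (M : Cl n) : Cl n :=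
  (toGrassmann n).symm
    (GradedAlgebra.proj (fun i : ℕ => ⋀[ℝ]^i (Vec n)) k (toGrassmann n M))

/-- The scalar part `⟨M⟩_0` of a multivector, as a real number. -/
def scalarPart {n : ℕ} (M : Cl n) : ℝ :=
  ExteriorAlgebra.algebraMapInv (toGrassmann n M)

/-- The modulus `|M|` of a multivector, `|M|² = ⟨M M̃⟩_0`. -/
def modulus {n : ℕ} (M : Cl n) : ℝ :=
  Real.sqrt (scalarPart (M * CliffordAlgebra.reverse M))

/-- `A` is an `r`-blade (`r ≥ 1`): an outer product of `r` linearly independent vectors. -/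
def IsBlade {n : ℕ} (r : ℕ) (A : Cl n) : Prop :=
  ∃ v : Fin r → Vec n, LinearIndependent ℝ v ∧ A = outerProd v

/-- The subspace `{x ∈ ℝⁿ | x ∧ A = 0}` represented by the blade `A`. -/
def bladeSpace {n : ℕ} (A : Cl n) : Submodule ℝ (Vec n) where
  carrier := {x | outer (vec x) A = 0}
  add_mem' := by
    intro x y hx hy
    simp only [Set.mem_ofPred_eq, outer, map_add, add_mul] at hx hy ⊢
    rw [hx, hy, add_zero]
  zero_mem' := by simp [outer]
  smul_mem' := by
    intro c x hx
    simp only [Set.mem_ofPred_eq, outer, map_smul, smul_mul_assoc] at hx ⊢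
    rw [hx, smul_zero]

/-- The geometric product `v₁ v₂ ⋯ v_r` of vectors. -/
def geomProd {n r : ℕ} (v : Fin r → Vec n) : Cl n :=
  (List.ofFn fun k => vec (v k)).prod

/-- `p₁, …, p_r` and `q₁, …, q_r` are principal vectors of the subspaces `U` and `W`: orthonormal
bases of `U` and `W` such that distinct pairs `{p_j, q_j}`, `{p_k, q_k}` are orthogonal to each
other and the angle between `p_k` and `q_k`, the `k`-th principal angle, is at most `π / 2`. -/
structure IsPrincipalVectors {n r : ℕ} (U W : Submodule ℝ (Vec n)) (p q : Fin r → Vec n) :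
    Prop where
  orthonormal_left : Orthonormal ℝ p
  orthonormal_right : Orthonormal ℝ q
  span_left : Submodule.span ℝ (Set.range p) = U
  span_right : Submodule.span ℝ (Set.range q) = W
  orthogonal_pairs : ∀ j k, j ≠ k → inner ℝ (p j) (q k) = 0
  angle_le : ∀ k, InnerProductGeometry.angle (p k) (q k) ≤ Real.pi / 2

/-- The blades `A` and `B` are orthogonally reshaped into principal vectors: `A = a₁ a₂ ⋯ a_r` and
`B = b₁ b₂ ⋯ b_r` are geometric products of nonzero, pairwise orthogonal vectors, and distinct
pairs `{a_j, b_j}`, `{a_k, b_k}` are orthogonal to each other. The lengths and the directions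
(signs) of the vectors are not normalized, since they carry the magnitudes and the orientations
of the blades. -/
structure IsPrincipalReshaping {n r : ℕ} (A B : Cl n) (a b : Fin r → Vec n) : Prop where
  ne_zero_left : ∀ k, a k ≠ 0
  ne_zero_right : ∀ k, b k ≠ 0
  orthogonal_left : ∀ j k, j ≠ k → inner ℝ (a j) (a k) = 0
  orthogonal_right : ∀ j k, j ≠ k → inner ℝ (b j) (b k) = 0
  orthogonal_pairs : ∀ j k, j ≠ k → inner ℝ (a j) (b k) = 0
  eq_left : A = geomProd a
  eq_right : B = geomProd b

/-- Cosine of the angle between two vectors. -/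
def cosAngle {n : ℕ} (x y : Vec n) : ℝ := Real.cos (InnerProductGeometry.angle x y)

/-- Sine of the angle between two vectors. -/
def sinAngle {n : ℕ} (x y : Vec n) : ℝ := Real.sin (InnerProductGeometry.angle x y)

/-- The unit bivector `x ∧ y / (|x| |y| sin θ)` of the plane spanned by `x` and `y`. For parallel
`x` and `y` there is no such plane, and the value is `0` by convention; it then only ever occurs
multiplied by `sin θ = 0`. -/
def unitBivector {n : ℕ} (x y : Vec n) : Cl n :=
  (‖x‖ * ‖y‖ * sinAngle x y)⁻¹ • outer (vec x) (vec y)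

/-- The product of the `i k` with `k ∈ S`, in increasing order of the index. -/
def orderedProd {n r : ℕ} (S : Finset (Fin r)) (i : Fin r → Cl n) : Cl n :=
  ((S.sort (· ≤ ·)).map i).prod

end SubspaceBlades

end

noncomputable section

namespace SubspaceBlades

open CliffordAlgebra (reverse)

variable {n r : ℕ}

/-! ### The canonical isomorphism on products of vectors -/

/-! For pairwise orthogonal vectors every contraction term vanishes, so their geometric product is
their outer product (`toGrassmann_prod`). A blade is therefore a nonzero multiple of the geometric
product of any orthonormal basis of its space (`IsBlade.exists_eq_smul_geomProd`), because changing
basis only multiplies an outer product by a determinant.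

A singular value decomposition of the orthogonal projection from one space to the other gives
orthonormal bases `p`, `q` with `p j ⟂ q k` for `j ≠ k`. The scalars of the two blades are absorbed
into a single pair, which yields the reshaping.

In `a₁ ⋯ a_r b_r ⋯ b₁` the vector `b j` anticommutes with both `a k` and `b k` for `k ≠ j`, so it
commutes with `a k * b k`. The product thus collapses from the inside to `∏ a k * b k`
(`prod_mul_reverse_prod`), and each factor is a length times `c k + s k • i k` (`vec_mul_vec`).
Writing `i k` as `a k * w k` with `w k ⟂ a k` in the plane of the pair makes `i_S` a geometric
product of `2|S|` pairwise orthogonal vectors, hence homogeneous of grade `2|S|`. All grade, scalar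
and modulus formulas are read off from this. For principal vectors, the blades are `α` and `β` times
unit blades, and `ε` is the sign of `αβ`. -/

/-- The functional by which `toGrassmann` contracts. -/
abbrev contractionDual (x : Vec n) : Module.Dual ℝ (Vec n) :=
  QuadraticMap.associated (R := ℝ) (M := Vec n) (-euclideanForm n) x

theorem euclideanForm_apply (x : Vec n) : euclideanForm n x = inner ℝ x x := rfl

/-- The sign comes from passing from the Euclidean form to the zero form, whose difference is
`-euclideanForm n`. It turns the subtraction in `toGrassmann_vec_mul` into the usual rule that `x M`
is `x ∧ M` plus the contraction of `M` by `x`. -/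
theorem contractionDual_apply (x y : Vec n) : contractionDual x y = -inner ℝ x y := by
  have h := LinearMap.congr_fun₂
    (QuadraticMap.two_nsmul_associated (R := ℝ) (S := ℝ) (-euclideanForm n)) x y
  simp only [LinearMap.smul_apply, QuadraticMap.polarBilin_apply_apply, QuadraticMap.polar,
    neg_apply, euclideanForm_apply, inner_add_left, inner_add_right,
    real_inner_comm x y, nsmul_eq_mul, Nat.cast_ofNat] at h
  rw [contractionDual]
  linarith

theorem toGrassmann_one : toGrassmann n 1 = 1 :=
  CliffordAlgebra.changeForm_one CliffordAlgebra.changeForm.associated_neg_proof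

theorem toGrassmann_algebraMap (x : ℝ) :
    toGrassmann n (algebraMap ℝ _ x) = algebraMap ℝ _ x :=
  CliffordAlgebra.changeForm_algebraMap CliffordAlgebra.changeForm.associated_neg_proof x

theorem toGrassmann_vec (x : Vec n) : toGrassmann n (vec x) = ExteriorAlgebra.ι ℝ x :=
  CliffordAlgebra.changeForm_ι CliffordAlgebra.changeForm.associated_neg_proof x

theorem toGrassmann_vec_mul (x : Vec n) (M : Cl n) :
    toGrassmann n (vec x * M) = ExteriorAlgebra.ι ℝ x * toGrassmann n M -
      CliffordAlgebra.contractLeft (Q := (0 : QuadraticForm ℝ (Vec n))) (contractionDual x)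
        (toGrassmann n M) :=
  CliffordAlgebra.changeForm_ι_mul CliffordAlgebra.changeForm.associated_neg_proof x M

/-- Contraction is an antiderivation, so each term of the expansion carries a factor `x · y`. -/
theorem contractLeft_prod_eq_zero (x : Vec n) (l : List (Vec n)) (h : ∀ y ∈ l, inner ℝ x y = 0) :
    CliffordAlgebra.contractLeft (Q := (0 : QuadraticForm ℝ (Vec n))) (contractionDual x)
      (l.map (ExteriorAlgebra.ι ℝ)).prod = 0 := by
  induction l with
  | nil =>
    exact CliffordAlgebra.contractLeft_one (Q := (0 : QuadraticForm ℝ (Vec n))) (contractionDual x)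
  | cons y l ih =>
    rw [List.map_cons, List.prod_cons]
    refine (CliffordAlgebra.contractLeft_ι_mul (Q := 0) _ _ _).trans ?_
    rw [ih fun z hz => h z (List.mem_cons_of_mem _ hz), contractionDual_apply,
      h y List.mem_cons_self]
    simp

/-- The geometric product of pairwise orthogonal vectors is their outer product. -/
theorem toGrassmann_prod (l : List (Vec n)) (h : l.Pairwise fun x y => inner ℝ x y = 0) :
    toGrassmann n (l.map vec).prod = (l.map (ExteriorAlgebra.ι ℝ)).prod := by
  induction l with
  | nil => exact toGrassmann_one
  | cons x l ih =>
    rw [List.pairwise_cons] at h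
    rw [List.map_cons, List.prod_cons, toGrassmann_vec_mul, ih h.2,
      contractLeft_prod_eq_zero x l h.1, sub_zero, List.map_cons, List.prod_cons]

theorem prod_map_ι_mem (l : List (Vec n)) :
    (l.map (ExteriorAlgebra.ι ℝ)).prod ∈ ⋀[ℝ]^l.length (Vec n) := by
  induction l with
  | nil => simp
  | cons x l ih =>
    rw [List.map_cons, List.prod_cons, List.length_cons]
    change _ ∈ LinearMap.range (ExteriorAlgebra.ι ℝ) ^ (l.length + 1)
    rw [pow_succ']
    exact Submodule.mul_mem_mul (LinearMap.mem_range_self _ x) ih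

theorem gradePart_prod (l : List (Vec n)) (h : l.Pairwise fun x y => inner ℝ x y = 0) (k : ℕ) :
    gradePart k (l.map vec).prod = if l.length = k then (l.map vec).prod else 0 := by
  have hm := prod_map_ι_mem l
  rw [← toGrassmann_prod l h] at hm
  unfold gradePart
  rw [GradedAlgebra.proj_apply]
  split_ifs with hk
  · rw [← hk, DirectSum.decompose_of_mem_same (fun i : ℕ => ⋀[ℝ]^i (Vec n)) hm,
      LinearEquiv.symm_apply_apply]
  · rw [DirectSum.decompose_of_mem_ne (fun i : ℕ => ⋀[ℝ]^i (Vec n)) hm hk, map_zero]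

theorem gradePart_smul (k : ℕ) (c : ℝ) (M : Cl n) : gradePart k (c • M) = c • gradePart k M := by
  simp [gradePart]

theorem gradePart_sum {ι : Type*} (k : ℕ) (s : Finset ι) (M : ι → Cl n) :
    gradePart k (∑ j ∈ s, M j) = ∑ j ∈ s, gradePart k (M j) := by
  simp only [gradePart, map_sum]

/-! ### Scalar part and modulus -/

theorem scalarPart_smul (c : ℝ) (M : Cl n) : scalarPart (c • M) = c * scalarPart M := by
  simp [scalarPart]

theorem scalarPart_sum {ι : Type*} (s : Finset ι) (M : ι → Cl n) :
    scalarPart (∑ j ∈ s, M j) = ∑ j ∈ s, scalarPart (M j) := by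
  simp only [scalarPart, map_sum]

theorem scalarPart_algebraMap (x : ℝ) : scalarPart (algebraMap ℝ (Cl n) x) = x := by
  rw [scalarPart, toGrassmann_algebraMap]
  exact ExteriorAlgebra.algebraMap_leftInverse _ x

theorem scalarPart_one : scalarPart (1 : Cl n) = 1 := by
  simpa using scalarPart_algebraMap (n := n) 1

/-- The scalar projection of the Grassmann algebra is multiplicative and kills vectors. -/
theorem scalarPart_prod (l : List (Vec n)) (h : l.Pairwise fun x y => inner ℝ x y = 0)
    (hl : l ≠ []) : scalarPart (l.map vec).prod = 0 := by
  rw [scalarPart, toGrassmann_prod l h]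
  obtain ⟨x, l, rfl⟩ := List.exists_cons_of_ne_nil hl
  rw [List.map_cons, List.prod_cons, map_mul]
  have : ExteriorAlgebra.algebraMapInv (ExteriorAlgebra.ι ℝ x) = (0 : ℝ) := by
    simp [ExteriorAlgebra.algebraMapInv]
  rw [this, zero_mul]

theorem modulus_smul (c : ℝ) (M : Cl n) : modulus (c • M) = |c| * modulus M := by
  rw [modulus, map_smul, smul_mul_smul_comm, scalarPart_smul, Real.sqrt_mul (mul_self_nonneg c),
    Real.sqrt_mul_self_eq_abs, modulus]

theorem modulus_eq_of_mul_reverse {M : Cl n} {x : ℝ} (hx : 0 ≤ x)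
    (h : M * reverse M = algebraMap ℝ _ (x ^ 2)) : modulus M = x := by
  rw [modulus, h, scalarPart_algebraMap, Real.sqrt_sq hx]

theorem vec_mul_self (x : Vec n) : vec x * vec x = algebraMap ℝ (Cl n) (‖x‖ ^ 2) := by
  rw [CliffordAlgebra.ι_sq_scalar, euclideanForm_apply, real_inner_self_eq_norm_sq]

theorem vec_mul_add_swap (x y : Vec n) :
    vec x * vec y + vec y * vec x = algebraMap ℝ (Cl n) (2 * inner ℝ x y) := by
  rw [CliffordAlgebra.ι_mul_ι_add_swap, QuadraticMap.polar]
  congr 1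
  simp only [euclideanForm_apply, inner_add_left, inner_add_right, real_inner_comm x y]
  ring

theorem vec_mul_comm_of_inner_eq_zero {x y : Vec n} (h : inner ℝ x y = 0) :
    vec x * vec y = -(vec y * vec x) := by
  have := vec_mul_add_swap x y
  rw [h, mul_zero, map_zero] at this
  exact eq_neg_of_add_eq_zero_left this

theorem outer_vec (x y : Vec n) :
    outer (vec x) (vec y) = vec x * vec y - algebraMap ℝ (Cl n) (inner ℝ x y) := by
  apply (toGrassmann n).injective
  rw [outer, LinearEquiv.apply_symm_apply, map_sub, toGrassmann_vec_mul, toGrassmann_vec,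
    toGrassmann_vec, toGrassmann_algebraMap]
  have := CliffordAlgebra.contractLeft_ι (0 : QuadraticForm ℝ (Vec n)) (contractionDual x) y
  rw [contractionDual_apply] at this
  erw [this]
  rw [map_neg, sub_neg_eq_add]
  exact (add_sub_cancel_right _ _).symm

/-! ### Geometric products of orthogonal vectors -/

theorem geomProd_eq_prod_map (v : Fin r → Vec n) :
    geomProd v = ((List.ofFn v).map vec).prod := by
  rw [geomProd, List.map_ofFn]; rfl

theorem pairwise_ofFn_of_orthogonal {v : Fin r → Vec n}
    (h : ∀ j k, j ≠ k → inner ℝ (v j) (v k) = 0) :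
    (List.ofFn v).Pairwise fun x y => inner ℝ x y = 0 :=
  List.pairwise_ofFn.2 fun _ _ hjk => h _ _ hjk.ne

theorem outerProd_eq_geomProd {v : Fin r → Vec n}
    (h : ∀ j k, j ≠ k → inner ℝ (v j) (v k) = 0) : outerProd v = geomProd v := by
  apply (toGrassmann n).injective
  rw [geomProd_eq_prod_map, toGrassmann_prod _ (pairwise_ofFn_of_orthogonal h), outerProd,
    LinearEquiv.apply_symm_apply, ExteriorAlgebra.ιMulti_apply, List.map_ofFn]
  rfl

/-- The innermost `M k * reverse (M k)` is a scalar, hence central, so the product collapses from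
the inside without any commutation of the factors. -/
theorem prod_mul_reverse {ι : Type*} (l : List ι) (M : ι → Cl n) (x : ι → ℝ)
    (h : ∀ k, M k * reverse (M k) = algebraMap ℝ _ (x k)) :
    (l.map M).prod * reverse (l.map M).prod = algebraMap ℝ _ (l.map x).prod := by
  induction l with
  | nil => simp
  | cons k l ih =>
    simp only [List.map_cons, List.prod_cons, CliffordAlgebra.reverse.map_mul, map_mul]
    rw [mul_assoc, ← mul_assoc _ (reverse (l.map M).prod), ih, Algebra.commutes, ← mul_assoc, h]

theorem modulus_geomProd (v : Fin r → Vec n) : modulus (geomProd v) = ∏ k, ‖v k‖ := by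
  refine modulus_eq_of_mul_reverse (Finset.prod_nonneg fun _ _ => norm_nonneg _) ?_
  rw [geomProd, List.ofFn_eq_map, prod_mul_reverse _ _ (fun k => ‖v k‖ ^ 2), ← List.ofFn_eq_map,
    List.prod_ofFn, Finset.prod_pow]
  intro k
  rw [CliffordAlgebra.reverse_ι, vec_mul_self]

theorem geomProd_ne_zero {v : Fin r → Vec n} (h : ∀ k, v k ≠ 0) : geomProd v ≠ 0 := by
  intro h0
  have h1 := modulus_geomProd v
  rw [h0] at h1
  have : (0 : ℝ) < ∏ k, ‖v k‖ := Finset.prod_pos fun k _ => norm_pos_iff.2 (h k)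
  simp [modulus, scalarPart] at h1
  linarith

theorem mem_bladeSpace (A : Cl n) (x : Vec n) : x ∈ bladeSpace A ↔ outer (vec x) A = 0 := Iff.rfl

/-- A geometric product of nonzero orthogonal vectors represents their span. -/
theorem bladeSpace_geomProd {v : Fin r → Vec n} (h0 : ∀ k, v k ≠ 0)
    (h : ∀ j k, j ≠ k → inner ℝ (v j) (v k) = 0) :
    bladeSpace (geomProd v) = Submodule.span ℝ (Set.range v) := by
  have key (x : Vec n) : outer (vec x) (geomProd v) = outerProd (Fin.cons x v) := by
    rw [← outerProd_eq_geomProd h, outer, outerProd, outerProd, LinearEquiv.apply_symm_apply,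
      toGrassmann_vec, ExteriorAlgebra.ιMulti_succ_apply]
    rfl
  have hle : Submodule.span ℝ (Set.range v) ≤ bladeSpace (geomProd v) := by
    rw [Submodule.span_le]
    rintro _ ⟨k, rfl⟩
    change outer _ _ = 0
    rw [key, outerProd]
    have : ExteriorAlgebra.ιMulti ℝ (r + 1) (Fin.cons (v k) v : Fin (r + 1) → Vec n) = 0 :=
      AlternatingMap.map_eq_zero_of_eq _ (i := 0) (j := k.succ) _ (by simp)
        (Fin.succ_ne_zero k).symm
    rw [this, map_zero]
  refine le_antisymm (fun x hx => ?_) hle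
  set U := Submodule.span ℝ (Set.range v)
  -- The component of `x` orthogonal to `U` also lies in the blade space. Were it nonzero, it would
  -- extend `v` to an orthogonal family of nonzero vectors, whose outer product cannot vanish.
  have hP : (U.orthogonalProjectionOnto x : Vec n) ∈ bladeSpace (geomProd v) := hle (Subtype.mem _)
  by_contra hxU
  have hy := (bladeSpace (geomProd v)).sub_mem hx hP
  rw [mem_bladeSpace, key, outerProd_eq_geomProd] at hy
  · refine geomProd_ne_zero (fun k => ?_) hy
    refine Fin.cases ?_ (fun j => ?_) k
    · intro h2
      apply hxU
      rw [Fin.cons_zero, sub_eq_zero] at h2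
      rw [h2]
      exact Subtype.mem _
    · simpa using h0 j
  · have hperp (k : Fin r) : inner ℝ (x - U.orthogonalProjectionOnto x : Vec n) (v k) = 0 :=
      Submodule.starProjection_inner_eq_zero x _ (Submodule.subset_span ⟨k, rfl⟩)
    intro j k
    refine Fin.cases ?_ (fun j => ?_) j <;> refine Fin.cases ?_ (fun k => ?_) k
    · simp
    · intro _; simpa using hperp k
    · intro _; rw [real_inner_comm]; simpa using hperp j
    · intro hjk; simpa using h j k (by simpa using hjk)

/-! ### Blades and orthonormal bases -/

/-- Alternating maps are determined on injective families of basis vectors. These are permutations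
of `e`, where both sides are the sign times `f e`. -/
theorem alternatingMap_eq_det_smul {M N ι : Type*} [AddCommGroup M] [Module ℝ M] [AddCommGroup N]
    [Module ℝ N] [Fintype ι] [DecidableEq ι] (f : M [⋀^ι]→ₗ[ℝ] N) (e : Module.Basis ι ℝ M)
    (v : ι → M) : f v = e.det v • f e := by
  have : f = (LinearMap.toSpanSingleton ℝ N (f e)).compAlternatingMap e.det := by
    refine e.ext_alternating fun σ hσ => ?_
    let τ : Equiv.Perm ι := Equiv.ofBijective σ (Finite.injective_iff_bijective.1 hσ)
    have h1 := f.map_perm e τ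
    have h2 := e.det.map_perm e τ
    rw [e.det_self] at h2
    simp only [LinearMap.compAlternatingMap_apply, LinearMap.toSpanSingleton_apply]
    change f (fun i => e (τ i)) = e.det (fun i => e (τ i)) • _
    change f (fun i => e (τ i)) = _ at h1
    change e.det (fun i => e (τ i)) = _ at h2
    rw [h1, h2]
    rcases Int.units_eq_one_or (Equiv.Perm.sign τ) with h | h <;> simp [h]
  exact DFunLike.congr_fun this v

theorem outerProd_smul_of_span_eq {v p : Fin r → Vec n} (hv : LinearIndependent ℝ v)
    (hp : LinearIndependent ℝ p)
    (h : Submodule.span ℝ (Set.range p) = Submodule.span ℝ (Set.range v)) :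
    ∃ c : ℝ, c ≠ 0 ∧ outerProd v = c • outerProd p := by
  let e := Module.Basis.span hp
  -- Restricted to the common span, `p` is a basis, and the constant sought is the determinant of
  -- `v` in it.
  let f : Submodule.span ℝ (Set.range p) [⋀^Fin r]→ₗ[ℝ] ExteriorAlgebra ℝ (Vec n) :=
    (ExteriorAlgebra.ιMulti ℝ r).compLinearMap (Submodule.subtype _)
  let w : Fin r → Submodule.span ℝ (Set.range p) := fun k =>
    ⟨v k, h ▸ Submodule.subset_span ⟨k, rfl⟩⟩
  have hw : LinearIndependent ℝ w :=
    LinearIndependent.of_comp (Submodule.subtype _) hv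
  have hunit : IsUnit (e.det w) := by
    rw [← Module.Basis.is_basis_iff_det]
    refine ⟨hw, ?_⟩
    apply hw.span_eq_top_of_card_eq_finrank'
    rw [finrank_span_eq_card hp]
  refine ⟨e.det w, hunit.ne_zero, ?_⟩
  have := alternatingMap_eq_det_smul f e w
  have h1 : f w = ExteriorAlgebra.ιMulti ℝ r v := rfl
  have h2 : f e = ExteriorAlgebra.ιMulti ℝ r p := by
    change ExteriorAlgebra.ιMulti ℝ r _ = _
    congr 1
    funext k
    exact congrArg Subtype.val (Module.Basis.span_apply hp k)
  rw [outerProd, ← h1, this, h2, map_smul, outerProd]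

theorem bladeSpace_smul {c : ℝ} (hc : c ≠ 0) (A : Cl n) : bladeSpace (c • A) = bladeSpace A := by
  ext x
  simp [mem_bladeSpace, outer, hc]

theorem span_range_coe_orthonormalBasis {U : Submodule ℝ (Vec n)}
    (b : OrthonormalBasis (Fin r) ℝ U) :
    Submodule.span ℝ (Set.range fun k => (b k : Vec n)) = U := by
  have : (Set.range fun k => (b k : Vec n)) = U.subtype '' Set.range b := by
    rw [← Set.range_comp]; rfl
  rw [this, Submodule.span_image, ← b.coe_toBasis, b.toBasis.span_eq, Submodule.map_top,
    Submodule.range_subtype]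

theorem bladeSpace_outerProd {v : Fin r → Vec n} (hv : LinearIndependent ℝ v) :
    bladeSpace (outerProd v) = Submodule.span ℝ (Set.range v) := by
  set U := Submodule.span ℝ (Set.range v) with hU
  have hr : Module.finrank ℝ U = r := by rw [hU, finrank_span_eq_card hv, Fintype.card_fin]
  let b := (stdOrthonormalBasis ℝ U).reindex (finCongr hr)
  have ho : Orthonormal ℝ fun k => (b k : Vec n) :=
    b.orthonormal.comp_linearIsometry U.subtypeₗᵢ
  have hs := span_range_coe_orthonormalBasis b
  obtain ⟨c, hc, h⟩ := outerProd_smul_of_span_eq hv ho.linearIndependent hs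
  rw [h, bladeSpace_smul hc, outerProd_eq_geomProd fun j k hjk => ho.inner_eq_zero hjk,
    bladeSpace_geomProd ho.ne_zero fun j k hjk => ho.inner_eq_zero hjk, hs]

theorem IsBlade.finrank_bladeSpace {A : Cl n} (hA : IsBlade r A) :
    Module.finrank ℝ (bladeSpace A) = r := by
  obtain ⟨v, hv, rfl⟩ := hA
  rw [bladeSpace_outerProd hv, finrank_span_eq_card hv, Fintype.card_fin]

/-- A blade is a multiple of the geometric product of any orthonormal basis of its space. -/
theorem IsBlade.exists_eq_smul_geomProd {A : Cl n} (hA : IsBlade r A) {p : Fin r → Vec n}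
    (hp : Orthonormal ℝ p) (hs : Submodule.span ℝ (Set.range p) = bladeSpace A) :
    ∃ c : ℝ, c ≠ 0 ∧ A = c • geomProd p := by
  obtain ⟨v, hv, rfl⟩ := hA
  rw [bladeSpace_outerProd hv] at hs
  rw [← outerProd_eq_geomProd fun j k hjk => hp.inner_eq_zero hjk]
  exact outerProd_smul_of_span_eq hv hp.linearIndependent hs

/-! ### Existence of principal vectors -/

theorem angle_le_pi_div_two_of_inner_nonneg {x y : Vec n} (h : 0 ≤ inner ℝ x y) :
    InnerProductGeometry.angle x y ≤ Real.pi / 2 :=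
  Real.arccos_le_pi_div_two.2 (div_nonneg h (by positivity))

/-- A linear map between Euclidean spaces of the same dimension has a singular value
decomposition. -/
theorem exists_singular_bases {E F : Type*} [NormedAddCommGroup E] [InnerProductSpace ℝ E]
    [FiniteDimensional ℝ E] [NormedAddCommGroup F] [InnerProductSpace ℝ F]
    [FiniteDimensional ℝ F] (hE : Module.finrank ℝ E = r) (hF : Module.finrank ℝ F = r)
    (T : E →ₗ[ℝ] F) :
    ∃ (p : OrthonormalBasis (Fin r) ℝ E) (q : OrthonormalBasis (Fin r) ℝ F),
      ∀ j k, if j = k then 0 ≤ inner ℝ (T (p j)) (q k) else inner ℝ (T (p j)) (q k) = 0 := by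
  -- An eigenbasis of `T* T` has pairwise orthogonal images under `T`. The nonzero ones, normalized,
  -- are part of `q`; the extension to a full basis is arbitrary at indices where `T (p k) = 0`.
  have hT : (T.adjoint ∘ₗ T).IsSymmetric := T.isSymmetric_adjoint_comp_self
  let p := hT.eigenvectorBasis hE
  have horth (j k : Fin r) (hjk : j ≠ k) : inner ℝ (T (p j)) (T (p k)) = 0 := by
    have h1 : T.adjoint (T (p k)) = hT.eigenvalues hE k • p k :=
      hT.apply_eigenvectorBasis hE k
    rw [← LinearMap.adjoint_inner_right, h1, inner_smul_right, p.orthonormal.inner_eq_zero hjk,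
      mul_zero]
  let w : Fin r → F := fun k => ‖T (p k)‖⁻¹ • T (p k)
  have hw : Orthonormal ℝ (Set.domRestrict {k | T (p k) ≠ 0} w) := by
    constructor
    · rintro ⟨k, hk⟩
      have : ‖T (p k)‖ ≠ 0 := norm_ne_zero_iff.2 hk
      simp [w, norm_smul, this]
    · rintro ⟨j, hj⟩ ⟨k, hk⟩ hjk
      have : j ≠ k := fun h => hjk (Subtype.ext h)
      simp [w, inner_smul_left, inner_smul_right, horth j k this]
  obtain ⟨q, hq⟩ := hw.exists_orthonormalBasis_extension_of_card_eq (by rw [hF, Fintype.card_fin])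
  refine ⟨p, q, fun j k => ?_⟩
  have hT (j : Fin r) : T (p j) = ‖T (p j)‖ • q j := by
    by_cases h : T (p j) = 0
    · simp [h]
    · rw [hq j h, smul_smul, mul_inv_cancel₀ (norm_ne_zero_iff.2 h), one_smul]
  split_ifs with h
  · subst h
    rw [hT, inner_smul_left, real_inner_self_eq_norm_sq]
    exact mul_nonneg (norm_nonneg (T (p j))) (sq_nonneg _)
  · rw [hT, inner_smul_left, q.orthonormal.inner_eq_zero h, mul_zero]

/-- Singular vectors of the orthogonal projection `U → W` serve, since projecting to `W` does not
change inner products with vectors of `W`. -/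
theorem exists_isPrincipalVectors {U W : Submodule ℝ (Vec n)} (hU : Module.finrank ℝ U = r)
    (hW : Module.finrank ℝ W = r) : ∃ p q : Fin r → Vec n, IsPrincipalVectors U W p q := by
  obtain ⟨p, q, h⟩ := exists_singular_bases hU hW
    ((W.orthogonalProjectionOnto : Vec n →ₗ[ℝ] W) ∘ₗ U.subtype)
  have h' (j k) : inner ℝ (((W.orthogonalProjectionOnto : Vec n →ₗ[ℝ] W) ∘ₗ U.subtype) (p j))
      (q k) = inner ℝ (p j : Vec n) (q k : Vec n) :=
    Submodule.inner_orthogonalProjectionOnto_eq_of_mem_right (q k) (p j : Vec n)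
  simp only [h'] at h
  refine ⟨fun k => p k, fun k => q k, p.orthonormal.comp_linearIsometry U.subtypeₗᵢ,
    q.orthonormal.comp_linearIsometry W.subtypeₗᵢ, span_range_coe_orthonormalBasis p,
    span_range_coe_orthonormalBasis q, fun j k hjk => ?_, fun k => ?_⟩
  · simpa [hjk] using h j k
  · exact angle_le_pi_div_two_of_inner_nonneg (by simpa using h k k)

/-! ### The plane of two vectors -/

/-- The component of `y` orthogonal to `x`. -/
def rejection (x y : Vec n) : Vec n := y - (inner ℝ x y / ‖x‖ ^ 2) • x

theorem inner_rejection {x : Vec n} (hx : x ≠ 0) (y : Vec n) : inner ℝ x (rejection x y) = 0 := by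
  have : ‖x‖ ≠ 0 := norm_ne_zero_iff.2 hx
  rw [rejection, inner_sub_right, inner_smul_right, real_inner_self_eq_norm_sq]
  field_simp
  ring

theorem inner_rejection_of_orthogonal {x y z : Vec n} (hx : inner ℝ z x = 0)
    (hy : inner ℝ z y = 0) : inner ℝ z (rejection x y) = 0 := by
  rw [rejection, inner_sub_right, inner_smul_right, hx, hy, mul_zero, sub_zero]

theorem norm_mul_norm_mul_cosAngle (x y : Vec n) : ‖x‖ * ‖y‖ * cosAngle x y = inner ℝ x y := by
  rw [cosAngle, mul_comm, InnerProductGeometry.cos_angle_mul_norm_mul_norm]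

theorem sinAngle_nonneg (x y : Vec n) : 0 ≤ sinAngle x y :=
  InnerProductGeometry.sin_angle_nonneg x y

theorem norm_rejection {x : Vec n} (hx : x ≠ 0) (y : Vec n) :
    ‖rejection x y‖ = ‖y‖ * sinAngle x y := by
  have hx' : ‖x‖ ≠ 0 := norm_ne_zero_iff.2 hx
  have hs : sinAngle x y ^ 2 = 1 - cosAngle x y ^ 2 := Real.sin_sq _
  rw [← sq_eq_sq₀ (norm_nonneg _) (mul_nonneg (norm_nonneg _) (sinAngle_nonneg x y)), mul_pow, hs,
    rejection, norm_sub_sq_real, inner_smul_right, norm_smul, real_inner_comm x y,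
    Real.norm_eq_abs, mul_pow, sq_abs, ← norm_mul_norm_mul_cosAngle]
  field_simp
  ring

/-- The part of `y` parallel to `x` contributes only the scalar `x · y` to `x y`. -/
theorem outer_eq_mul_rejection {x : Vec n} (hx : x ≠ 0) (y : Vec n) :
    outer (vec x) (vec y) = vec x * vec (rejection x y) := by
  have hx' : ‖x‖ ^ 2 ≠ 0 := pow_ne_zero 2 (norm_ne_zero_iff.2 hx)
  rw [outer_vec, rejection, map_sub, map_smul, mul_sub, mul_smul_comm, vec_mul_self,
    Algebra.smul_def, ← RingHom.map_mul, div_mul_cancel₀ _ hx']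

/-- A vector `w` orthogonal to `x` such that the unit bivector of `x` and `y` is `x w`. -/
def unitCofactor (x y : Vec n) : Vec n := (‖x‖ * ‖y‖ * sinAngle x y)⁻¹ • rejection x y

theorem unitBivector_eq_mul {x : Vec n} (hx : x ≠ 0) (y : Vec n) :
    unitBivector x y = vec x * vec (unitCofactor x y) := by
  rw [unitBivector, unitCofactor, outer_eq_mul_rejection hx, map_smul, mul_smul_comm]

theorem inner_unitCofactor {x : Vec n} (hx : x ≠ 0) (y : Vec n) :
    inner ℝ x (unitCofactor x y) = 0 := by
  rw [unitCofactor, inner_smul_right, inner_rejection hx, mul_zero]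

theorem inner_unitCofactor_of_orthogonal {x y z : Vec n} (hx : inner ℝ z x = 0)
    (hy : inner ℝ z y = 0) : inner ℝ z (unitCofactor x y) = 0 := by
  rw [unitCofactor, inner_smul_right, inner_rejection_of_orthogonal hx hy, mul_zero]

theorem norm_mul_norm_unitCofactor {x y : Vec n} (hx : x ≠ 0) (hy : y ≠ 0)
    (hs : sinAngle x y ≠ 0) : ‖x‖ * ‖unitCofactor x y‖ = 1 := by
  have hx' : ‖x‖ ≠ 0 := norm_ne_zero_iff.2 hx
  have hy' : ‖y‖ ≠ 0 := norm_ne_zero_iff.2 hy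
  rw [unitCofactor, norm_smul, norm_rejection hx, norm_inv, norm_mul, norm_mul, norm_norm,
    norm_norm, Real.norm_of_nonneg (sinAngle_nonneg x y)]
  field_simp

theorem vec_mul_vec {x y : Vec n} (hx : x ≠ 0) (hy : y ≠ 0) : vec x * vec y =
    (‖x‖ * ‖y‖) • (algebraMap ℝ (Cl n) (cosAngle x y) + sinAngle x y • unitBivector x y) := by
  have hx' : ‖x‖ ≠ 0 := norm_ne_zero_iff.2 hx
  have hy' : ‖y‖ ≠ 0 := norm_ne_zero_iff.2 hy
  have h : (‖x‖ * ‖y‖) • sinAngle x y • unitBivector x y = outer (vec x) (vec y) := by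
    rw [smul_smul]
    -- For parallel vectors the rejection has norm zero, so the outer product vanishes as well.
    by_cases hs : sinAngle x y = 0
    · have h0 : rejection x y = 0 := by rw [← norm_eq_zero, norm_rejection hx, hs, mul_zero]
      rw [hs, mul_zero, zero_smul, outer_eq_mul_rejection hx, h0, map_zero, mul_zero]
    · rw [unitBivector, smul_smul, mul_inv_cancel₀ (mul_ne_zero (mul_ne_zero hx' hy') hs), one_smul]
  rw [smul_add, h, Algebra.smul_def, ← RingHom.map_mul, norm_mul_norm_mul_cosAngle, outer_vec]
  abel

theorem unitBivector_mul_reverse {x y : Vec n} (hx : x ≠ 0) (hy : y ≠ 0)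
    (hs : sinAngle x y ≠ 0) : unitBivector x y * reverse (unitBivector x y) = 1 := by
  rw [unitBivector_eq_mul hx, CliffordAlgebra.reverse.map_mul, CliffordAlgebra.reverse_ι,
    CliffordAlgebra.reverse_ι, mul_assoc, ← mul_assoc (vec (unitCofactor x y)), vec_mul_self,
    Algebra.commutes, ← mul_assoc, vec_mul_self, ← map_mul, ← mul_pow,
    norm_mul_norm_unitCofactor hx hy hs, one_pow, map_one]

theorem reverse_unitBivector {x : Vec n} (hx : x ≠ 0) (y : Vec n) :
    reverse (unitBivector x y) = -unitBivector x y := by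
  rw [unitBivector_eq_mul hx, CliffordAlgebra.reverse.map_mul, CliffordAlgebra.reverse_ι,
    CliffordAlgebra.reverse_ι, vec_mul_comm_of_inner_eq_zero (inner_unitCofactor hx y), neg_neg]

theorem unitBivector_mul_self {x y : Vec n} (hx : x ≠ 0) (hy : y ≠ 0)
    (hs : sinAngle x y ≠ 0) : unitBivector x y * unitBivector x y = -1 := by
  rw [← unitBivector_mul_reverse hx hy hs, reverse_unitBivector hx, mul_neg, neg_neg]

theorem modulus_unitBivector {x y : Vec n} (hx : x ≠ 0) (hy : y ≠ 0)
    (hs : sinAngle x y ≠ 0) : modulus (unitBivector x y) = 1 :=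
  modulus_eq_of_mul_reverse zero_le_one (by simpa using unitBivector_mul_reverse hx hy hs)

theorem unitBivector_isBlade_and_bladeSpace {x y : Vec n} (hx : x ≠ 0) (hy : y ≠ 0)
    (hs : sinAngle x y ≠ 0) :
    IsBlade 2 (unitBivector x y) ∧ bladeSpace (unitBivector x y) = Submodule.span ℝ {x, y} := by
  have hw : unitCofactor x y ≠ 0 := by
    intro h
    have := norm_mul_norm_unitCofactor hx hy hs
    simp [h] at this
  have h0 : ∀ k, ![x, unitCofactor x y] k ≠ 0 := by
    intro k; fin_cases k <;> simpa
  have ho : ∀ j k, j ≠ k → inner ℝ (![x, unitCofactor x y] j) (![x, unitCofactor x y] k) = 0 := by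
    have h1 := inner_unitCofactor hx y
    have h2 := (real_inner_comm x (unitCofactor x y)).trans h1
    intro j k hjk
    fin_cases j <;> fin_cases k <;> simp_all
  have he : unitBivector x y = geomProd ![x, unitCofactor x y] := by
    rw [unitBivector_eq_mul hx]
    simp [geomProd]
  refine ⟨⟨_, linearIndependent_of_ne_zero_of_inner_eq_zero h0 fun j k hjk => ho j k hjk,
    he.trans (outerProd_eq_geomProd ho).symm⟩, ?_⟩
  rw [he, bladeSpace_geomProd h0 ho, Matrix.range_cons_cons_empty]
  have hc : (‖x‖ * ‖y‖ * sinAngle x y) ≠ 0 :=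
    mul_ne_zero (mul_ne_zero (norm_ne_zero_iff.2 hx) (norm_ne_zero_iff.2 hy)) hs
  have hxm : ∀ z : Vec n, x ∈ Submodule.span ℝ {x, z} := fun z =>
    Submodule.subset_span (Set.mem_insert _ _)
  have hzm : ∀ z : Vec n, z ∈ Submodule.span ℝ {x, z} := fun z =>
    Submodule.subset_span (Set.mem_insert_of_mem _ rfl)
  have hr : rejection x y = (‖x‖ * ‖y‖ * sinAngle x y) • unitCofactor x y := by
    rw [unitCofactor, smul_smul, mul_inv_cancel₀ hc, one_smul]
  apply le_antisymm <;> rw [Submodule.span_le, Set.insert_subset_iff, Set.singleton_subset_iff]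
  · refine ⟨hxm _, ?_⟩
    exact Submodule.smul_mem _ _ (Submodule.sub_mem _ (hzm y) (Submodule.smul_mem _ _ (hxm y)))
  · refine ⟨hxm _, ?_⟩
    have hy : rejection x y ∈ Submodule.span ℝ {x, unitCofactor x y} := by
      rw [hr]
      exact Submodule.smul_mem _ _ (hzm _)
    exact (Submodule.sub_mem_iff_left _ (Submodule.smul_mem _ _ (hxm _))).1 hy

/-! ### Commutation and products over lists -/

/-- Passing two orthogonal vectors costs two signs, which cancel. -/
theorem commute_vec_mul {x z w : Vec n} (hz : inner ℝ x z = 0) (hw : inner ℝ x w = 0) :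
    Commute (vec x) (vec z * vec w) := by
  rw [Commute, SemiconjBy, ← mul_assoc, vec_mul_comm_of_inner_eq_zero hz, neg_mul, mul_assoc,
    vec_mul_comm_of_inner_eq_zero hw, mul_neg, neg_neg, mul_assoc]

theorem commute_mul_mul {x y z w : Vec n} (hxz : inner ℝ x z = 0) (hxw : inner ℝ x w = 0)
    (hyz : inner ℝ y z = 0) (hyw : inner ℝ y w = 0) :
    Commute (vec x * vec y) (vec z * vec w) :=
  (commute_vec_mul hxz hxw).mul_left (commute_vec_mul hyz hyw)

/-- The outermost `g j` moves left past the already collapsed inner pairs until it meets `f j`. -/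
theorem prod_mul_reverse_prod {ι R : Type*} [Monoid R] (f g : ι → R)
    (h : ∀ j k, j ≠ k → Commute (g j) (f k * g k)) (l : List ι) (hl : l.Nodup) :
    (l.map f).prod * (l.map g).reverse.prod = (l.map fun k => f k * g k).prod := by
  induction l with
  | nil => simp
  | cons j l ih =>
    rw [List.nodup_cons] at hl
    have hc : Commute (g j) (l.map fun k => f k * g k).prod := by
      refine Commute.list_prod_right _ _ fun y hy => ?_
      obtain ⟨k, hk, rfl⟩ := List.mem_map.1 hy
      exact h j k fun hjk => hl.1 (hjk ▸ hk)
    simp only [List.map_cons, List.prod_cons, List.reverse_cons, List.prod_append, List.prod_nil,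
      mul_one]
    rw [mul_assoc, ← mul_assoc _ _ (g j), ih hl.2, ← hc.eq, mul_assoc]

theorem prod_smul_list {ι R : Type*} [Ring R] [Algebra ℝ R] (l : List ι) (t : ι → ℝ) (f : ι → R) :
    (l.map fun k => t k • f k).prod = (l.map t).prod • (l.map f).prod := by
  induction l with
  | nil => simp
  | cons j l ih => simp [ih, smul_smul, mul_comm]

theorem orderedProd_univ (i : Fin r → Cl n) : orderedProd Finset.univ i = (List.ofFn i).prod := by
  rw [orderedProd, Fin.sort_univ, List.ofFn_eq_map]

theorem orderedProd_insert {s : Finset (Fin r)} {k : Fin r} (h : ∀ j ∈ s, k < j)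
    (i : Fin r → Cl n) : orderedProd (insert k s) i = i k * orderedProd s i := by
  rw [orderedProd, Finset.sort_insert _ (fun j hj => (h j hj).le) fun hk => (h k hk).false,
    List.map_cons, List.prod_cons, orderedProd]

/-- The distributive law for ordered factors. Adding a new minimum `j` puts its factor on the far
left, and the subsets split by whether they contain `j`, so the `i k` need not commute. -/
theorem orderedProd_scalar_add (s : Finset (Fin r)) (c t : Fin r → ℝ) (i : Fin r → Cl n) :
    orderedProd s (fun k => algebraMap ℝ (Cl n) (c k) + t k • i k) =
      ∑ S ∈ s.powerset, ((∏ k ∈ S, t k) * ∏ k ∈ s \ S, c k) • orderedProd S i := by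
  induction s using Finset.induction_on_min with
  | empty => simp [orderedProd]
  | insert j s hj ih =>
    have hjs : j ∉ s := fun h => (hj j h).false
    rw [orderedProd_insert hj, ih, Finset.sum_powerset_insert hjs, add_mul, Finset.mul_sum,
      Finset.mul_sum]
    congr 1
    · refine Finset.sum_congr rfl fun S hS => ?_
      have hjS : j ∉ S := fun h => hjs (Finset.mem_powerset.1 hS h)
      rw [Finset.insert_sdiff_of_notMem _ hjS, Finset.prod_insert (by simp [hjs]),
        ← Algebra.smul_def, smul_smul]
      ring_nf
    · refine Finset.sum_congr rfl fun S hS => ?_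
      have hSs := Finset.mem_powerset.1 hS
      have hjS : j ∉ S := fun h => hjs (hSs h)
      rw [Finset.prod_insert hjS, Finset.insert_sdiff_insert,
        Finset.sdiff_insert_of_notMem hjs, orderedProd_insert fun k hk => hj k (hSs hk),
        smul_mul_smul_comm, mul_assoc]

theorem prod_ofFn_scalar_add (c t : Fin r → ℝ) (i : Fin r → Cl n) :
    (List.ofFn fun k => algebraMap ℝ (Cl n) (c k) + t k • i k).prod =
      ∑ S : Finset (Fin r), ((∏ k ∈ S, t k) * ∏ k ∈ Sᶜ, c k) • orderedProd S i := by
  rw [← orderedProd_univ, orderedProd_scalar_add, Finset.powerset_univ]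
  rfl

/-! ### Products of mutually orthogonal bivectors -/

theorem prod_map_mul_eq_prod_flatMap {ι : Type*} (l : List ι) (u w : ι → Vec n) :
    (l.map fun k => vec (u k) * vec (w k)).prod =
      ((l.flatMap fun k => [u k, w k]).map vec).prod := by
  induction l with
  | nil => simp
  | cons k l ih => simp [ih, mul_assoc]

theorem pairwise_flatMap_pairs {ι : Type*} {u w : ι → Vec n}
    (huw : ∀ k, inner ℝ (u k) (w k) = 0)
    (h : ∀ j k, j ≠ k → ∀ x ∈ [u j, w j], ∀ y ∈ [u k, w k], inner ℝ x y = 0)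
    {l : List ι} (hl : l.Nodup) :
    (l.flatMap fun k => [u k, w k]).Pairwise fun x y => inner ℝ x y = 0 := by
  rw [List.pairwise_flatMap]
  exact ⟨fun k _ => by simp [huw k], hl.imp fun {j k} hjk => h j k hjk⟩

theorem length_flatMap_pairs {ι : Type*} (u w : ι → Vec n) (l : List ι) :
    (l.flatMap fun k => [u k, w k]).length = 2 * l.length := by
  induction l with
  | nil => rfl
  | cons k l ih => simp [ih]; ring

/-! ### Reshaped blades -/

namespace IsPrincipalReshaping

variable {A B : Cl n} {a b : Fin r → Vec n}

theorem orthogonal_pairs_symm (h : IsPrincipalReshaping A B a b) (j k : Fin r) (hjk : j ≠ k) :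
    inner ℝ (b j) (a k) = 0 := by
  rw [real_inner_comm]
  exact h.orthogonal_pairs k j hjk.symm

/-- Each cofactor is a combination of `a k` and `b k`, so it inherits the orthogonality of distinct
pairs. -/
theorem orthogonal_cofactors (h : IsPrincipalReshaping A B a b) (j k : Fin r) (hjk : j ≠ k) :
    ∀ x ∈ [a j, unitCofactor (a j) (b j)], ∀ y ∈ [a k, unitCofactor (a k) (b k)],
      inner ℝ x y = 0 := by
  have key (j k : Fin r) (hjk : j ≠ k) : inner ℝ (a j) (unitCofactor (a k) (b k)) = 0 :=
    inner_unitCofactor_of_orthogonal (h.orthogonal_left j k hjk) (h.orthogonal_pairs j k hjk)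
  have key' (j k : Fin r) (hjk : j ≠ k) : inner ℝ (b j) (unitCofactor (a k) (b k)) = 0 :=
    inner_unitCofactor_of_orthogonal (h.orthogonal_pairs_symm j k hjk) (h.orthogonal_right j k hjk)
  intro x hx y hy
  simp only [List.mem_cons, List.not_mem_nil, or_false] at hx hy
  rcases hx with rfl | rfl <;> rcases hy with rfl | rfl
  · exact h.orthogonal_left j k hjk
  · exact key j k hjk
  · rw [real_inner_comm]
    exact key k j hjk.symm
  · rw [real_inner_comm]
    apply inner_unitCofactor_of_orthogonal <;> rw [real_inner_comm]
    · exact key j k hjk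
    · exact key' j k hjk

theorem commute_unitBivector (h : IsPrincipalReshaping A B a b) (j k : Fin r) (hjk : j ≠ k) :
    Commute (unitBivector (a j) (b j)) (unitBivector (a k) (b k)) := by
  have := h.orthogonal_cofactors j k hjk
  rw [unitBivector_eq_mul (h.ne_zero_left j), unitBivector_eq_mul (h.ne_zero_left k)]
  apply commute_mul_mul <;> exact this _ (by simp) _ (by simp)

theorem isOrtho_span (h : IsPrincipalReshaping A B a b) (j k : Fin r) (hjk : j ≠ k) :
    Submodule.span ℝ {a j, b j} ⟂ Submodule.span ℝ {a k, b k} := by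
  rw [Submodule.isOrtho_span]
  rintro x (rfl | rfl) y (rfl | rfl)
  · exact h.orthogonal_left j k hjk
  · exact h.orthogonal_pairs j k hjk
  · exact h.orthogonal_pairs_symm j k hjk
  · exact h.orthogonal_right j k hjk

theorem prod_map_unitBivector (h : IsPrincipalReshaping A B a b) (l : List (Fin r)) :
    (l.map fun k => unitBivector (a k) (b k)).prod =
      ((l.flatMap fun k => [a k, unitCofactor (a k) (b k)]).map vec).prod := by
  rw [← prod_map_mul_eq_prod_flatMap]
  simp only [unitBivector_eq_mul (h.ne_zero_left _)]

theorem pairwise_flatMap (h : IsPrincipalReshaping A B a b) {l : List (Fin r)} (hl : l.Nodup) :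
    (l.flatMap fun k => [a k, unitCofactor (a k) (b k)]).Pairwise fun x y => inner ℝ x y = 0 :=
  pairwise_flatMap_pairs (fun k => inner_unitCofactor (h.ne_zero_left k) _)
    h.orthogonal_cofactors hl

theorem scalarPart_mul_reverse_unitBivector (h : IsPrincipalReshaping A B a b) (j k : Fin r)
    (hjk : j ≠ k) :
    scalarPart (unitBivector (a j) (b j) * reverse (unitBivector (a k) (b k))) = 0 := by
  have h1 := h.prod_map_unitBivector [j, k]
  simp only [List.map_cons, List.map_nil, List.prod_cons, List.prod_nil, mul_one] at h1
  rw [reverse_unitBivector (h.ne_zero_left k), mul_neg, ← neg_one_smul ℝ, scalarPart_smul, h1]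
  have := scalarPart_prod _ (h.pairwise_flatMap (l := [j, k]) (by simpa using hjk)) (by simp)
  simp only [List.map_cons, List.map_nil, List.prod_cons, List.prod_nil, mul_one,
    List.flatMap_cons, List.flatMap_nil, List.append_nil, List.cons_append, List.nil_append]
    at this ⊢
  rw [this, mul_zero]

/-- Expanding each `i k` as `a k` times its cofactor gives `2|S|` pairwise orthogonal vectors. If
some `i k` is zero, both sides vanish. -/
theorem gradePart_orderedProd (h : IsPrincipalReshaping A B a b) (S : Finset (Fin r)) (m : ℕ) :
    gradePart m (orderedProd S fun k => unitBivector (a k) (b k)) =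
      if 2 * S.card = m then orderedProd S fun k => unitBivector (a k) (b k) else 0 := by
  rw [orderedProd, h.prod_map_unitBivector,
    gradePart_prod _ (h.pairwise_flatMap (Finset.sort_nodup _ _)), length_flatMap_pairs,
    Finset.length_sort]

theorem scalarPart_orderedProd (h : IsPrincipalReshaping A B a b) (S : Finset (Fin r)) :
    scalarPart (orderedProd S fun k => unitBivector (a k) (b k)) = if S = ∅ then 1 else 0 := by
  split_ifs with hS
  · subst hS
    simpa [orderedProd] using scalarPart_one
  · rw [orderedProd, h.prod_map_unitBivector,
      scalarPart_prod _ (h.pairwise_flatMap (Finset.sort_nodup _ _))]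
    rw [← List.length_pos_iff, length_flatMap_pairs, Finset.length_sort]
    have := Finset.card_pos.2 (Finset.nonempty_iff_ne_empty.2 hS)
    omega

theorem modulus_left (h : IsPrincipalReshaping A B a b) : modulus A = ∏ k, ‖a k‖ := by
  rw [h.eq_left, modulus_geomProd]

theorem modulus_right (h : IsPrincipalReshaping A B a b) : modulus B = ∏ k, ‖b k‖ := by
  rw [h.eq_right, modulus_geomProd]

theorem modulus_mul_pos (h : IsPrincipalReshaping A B a b) : 0 < modulus A * modulus B := by
  rw [h.modulus_left, h.modulus_right]
  exact mul_pos (Finset.prod_pos fun k _ => norm_pos_iff.2 (h.ne_zero_left k))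
    (Finset.prod_pos fun k _ => norm_pos_iff.2 (h.ne_zero_right k))

theorem mul_reverse_eq (h : IsPrincipalReshaping A B a b) : A * reverse B =
    (List.ofFn fun k => vec (a k)).prod * ((List.ofFn fun k => vec (b k)).reverse).prod := by
  have := CliffordAlgebra.reverse_prod_map_ι (Q := euclideanForm n) (List.ofFn b)
  rw [h.eq_right, geomProd_eq_prod_map, this, h.eq_left, geomProd, List.map_ofFn]
  rfl

theorem mul_reverse_eq_prod (h : IsPrincipalReshaping A B a b) :
    A * reverse B = (List.ofFn fun k => vec (a k) * vec (b k)).prod := by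
  rw [h.mul_reverse_eq, List.ofFn_eq_map, List.ofFn_eq_map, List.ofFn_eq_map]
  refine prod_mul_reverse_prod _ _ (fun j k hjk => ?_) _ (List.nodup_finRange r)
  exact commute_vec_mul (h.orthogonal_pairs_symm j k hjk) (h.orthogonal_right j k hjk)

theorem mul_reverse_eq_rotors (h : IsPrincipalReshaping A B a b) :
    A * reverse B = (modulus A * modulus B) • (List.ofFn fun k =>
      algebraMap ℝ (Cl n) (cosAngle (a k) (b k)) +
        sinAngle (a k) (b k) • unitBivector (a k) (b k)).prod := by
  rw [h.mul_reverse_eq_prod, List.ofFn_eq_map, List.ofFn_eq_map]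
  simp only [vec_mul_vec (h.ne_zero_left _) (h.ne_zero_right _)]
  rw [prod_smul_list, ← List.ofFn_eq_map, List.prod_ofFn, Finset.prod_mul_distrib,
    h.modulus_left, h.modulus_right]

theorem mul_reverse_eq_sum (h : IsPrincipalReshaping A B a b) :
    A * reverse B = (modulus A * modulus B) • ∑ S : Finset (Fin r),
      ((∏ k ∈ S, sinAngle (a k) (b k)) * ∏ k ∈ Sᶜ, cosAngle (a k) (b k)) •
        orderedProd S fun k => unitBivector (a k) (b k) := by
  rw [h.mul_reverse_eq_rotors, prod_ofFn_scalar_add]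

theorem gradePart_even (h : IsPrincipalReshaping A B a b) (m : ℕ) :
    gradePart (2 * m) (A * reverse B) = (modulus A * modulus B) •
      ∑ S ∈ Finset.powersetCard m (Finset.univ : Finset (Fin r)),
        ((∏ k ∈ S, sinAngle (a k) (b k)) * ∏ k ∈ Sᶜ, cosAngle (a k) (b k)) •
          orderedProd S fun k => unitBivector (a k) (b k) := by
  rw [h.mul_reverse_eq_sum, gradePart_smul, gradePart_sum, ← Finset.univ_filter_card_eq,
    Finset.sum_filter]
  simp only [gradePart_smul, h.gradePart_orderedProd, mul_right_inj' two_ne_zero, smul_ite,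
    smul_zero]

theorem gradePart_odd (h : IsPrincipalReshaping A B a b) (m : ℕ) :
    gradePart (2 * m + 1) (A * reverse B) = 0 := by
  rw [h.mul_reverse_eq_sum, gradePart_smul, gradePart_sum, Finset.sum_eq_zero, smul_zero]
  intro S _
  rw [gradePart_smul, h.gradePart_orderedProd, if_neg (by omega), smul_zero]

theorem scalarPart_mul_reverse (h : IsPrincipalReshaping A B a b) :
    scalarPart (A * reverse B) = modulus A * modulus B * ∏ k, cosAngle (a k) (b k) := by
  rw [h.mul_reverse_eq_sum, scalarPart_smul, scalarPart_sum]
  simp [scalarPart_smul, h.scalarPart_orderedProd]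

theorem gradePart_two (h : IsPrincipalReshaping A B a b) :
    gradePart 2 (A * reverse B) = (modulus A * modulus B) • ∑ k,
      (sinAngle (a k) (b k) * ∏ j ∈ Finset.univ.erase k, cosAngle (a j) (b j)) •
        unitBivector (a k) (b k) := by
  rw [← mul_one 2, h.gradePart_even 1, Finset.powersetCard_one, Finset.sum_map]
  congr 1
  refine Finset.sum_congr rfl fun k _ => ?_
  simp [orderedProd, Finset.sdiff_singleton_eq_erase, Finset.compl_eq_univ_sdiff]

theorem gradePart_two_mul (h : IsPrincipalReshaping A B a b) :
    gradePart (2 * r) (A * reverse B) =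
      (modulus A * modulus B * ∏ k, sinAngle (a k) (b k)) •
        (List.ofFn fun k => unitBivector (a k) (b k)).prod := by
  have : Finset.powersetCard r (Finset.univ : Finset (Fin r)) = {Finset.univ} := by
    simpa using Finset.powersetCard_self (Finset.univ : Finset (Fin r))
  rw [h.gradePart_even r, this, Finset.sum_singleton, orderedProd_univ]
  simp [smul_smul]

theorem modulus_gradePart (h : IsPrincipalReshaping A B a b) :
    modulus (gradePart (2 * r) (A * reverse B)) =
      modulus A * modulus B * ∏ k, sinAngle (a k) (b k) := by
  have h0 : 0 ≤ modulus A * modulus B * ∏ k, sinAngle (a k) (b k) :=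
    mul_nonneg h.modulus_mul_pos.le (Finset.prod_nonneg fun k _ => sinAngle_nonneg _ _)
  rw [h.gradePart_two_mul, modulus_smul, abs_of_nonneg h0]
  -- The product of the `i k` has modulus one only when no sine vanishes; otherwise the coefficient
  -- is already zero.
  by_cases hs : ∏ k, sinAngle (a k) (b k) = 0
  · rw [hs, mul_zero, zero_mul]
  · rw [← ne_eq, Finset.prod_ne_zero_iff] at hs
    rw [modulus_eq_of_mul_reverse (M := (List.ofFn fun k => unitBivector (a k) (b k)).prod)
      zero_le_one, mul_one]
    rw [List.ofFn_eq_map, prod_mul_reverse _ _ (fun _ => 1)]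
    · simp
    · intro k
      rw [unitBivector_mul_reverse (h.ne_zero_left k) (h.ne_zero_right k)
        (hs k (Finset.mem_univ k)), map_one]

end IsPrincipalReshaping

/-! ### Blades in terms of principal vectors -/

theorem geomProd_smul (t : Fin r → ℝ) (v : Fin r → Vec n) :
    geomProd (fun k => t k • v k) = (∏ k, t k) • geomProd v := by
  rw [geomProd, geomProd, List.ofFn_eq_map, List.ofFn_eq_map]
  simp only [map_smul]
  rw [prod_smul_list, ← List.ofFn_eq_map, List.prod_ofFn]

theorem modulus_geomProd_of_orthonormal {p : Fin r → Vec n} (hp : Orthonormal ℝ p) :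
    modulus (geomProd p) = 1 := by
  simp [modulus_geomProd, hp.norm_eq_one]

namespace IsPrincipalVectors

variable {U W : Submodule ℝ (Vec n)} {p q : Fin r → Vec n}

theorem isPrincipalReshaping (h : IsPrincipalVectors U W p q) :
    IsPrincipalReshaping (geomProd p) (geomProd q) p q where
  ne_zero_left := h.orthonormal_left.ne_zero
  ne_zero_right := h.orthonormal_right.ne_zero
  orthogonal_left _ _ hjk := h.orthonormal_left.inner_eq_zero hjk
  orthogonal_right _ _ hjk := h.orthonormal_right.inner_eq_zero hjk
  orthogonal_pairs := h.orthogonal_pairs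
  eq_left := rfl
  eq_right := rfl

theorem cosAngle_eq_inner (h : IsPrincipalVectors U W p q) (k : Fin r) :
    cosAngle (p k) (q k) = inner ℝ (p k) (q k) := by
  rw [← norm_mul_norm_mul_cosAngle, h.orthonormal_left.norm_eq_one,
    h.orthonormal_right.norm_eq_one, one_mul, one_mul]

theorem cosAngle_nonneg (h : IsPrincipalVectors U W p q) (k : Fin r) :
    0 ≤ cosAngle (p k) (q k) :=
  Real.cos_nonneg_of_neg_pi_div_two_le_of_le
    (by linarith [Real.pi_pos, InnerProductGeometry.angle_nonneg (p k) (q k)]) (h.angle_le k)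

/-- The magnitudes and orientations of two blades can be absorbed into one pair of principal
vectors. -/
theorem reshape (h : IsPrincipalVectors U W p q) {α β : ℝ} (hα : α ≠ 0) (hβ : β ≠ 0)
    (j : Fin r) :
    ∃ a b : Fin r → Vec n,
      IsPrincipalReshaping (α • geomProd p) (β • geomProd q) a b ∧
      (∀ k, k ≠ j → InnerProductGeometry.angle (a k) (b k) ≤ Real.pi / 2) ∧
      (0 ≤ α * β * inner ℝ (p j) (q j) →
        ∀ k, InnerProductGeometry.angle (a k) (b k) ≤ Real.pi / 2) := by
  -- `Pi.mulSingle j γ` is `γ` at `j` and `1` elsewhere, so only the pair at `j` is rescaled and the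
  -- total factor is `γ`.
  have hne {γ : ℝ} (hγ : γ ≠ 0) (k : Fin r) : (Pi.mulSingle j γ : Fin r → ℝ) k ≠ 0 := by
    rcases eq_or_ne k j with rfl | hk
    · simpa
    · simp [hk]
  have hang (k : Fin r) (hk : k ≠ j) :
      InnerProductGeometry.angle ((Pi.mulSingle j α : Fin r → ℝ) k • p k)
        ((Pi.mulSingle j β : Fin r → ℝ) k • q k) ≤ Real.pi / 2 := by
    simpa [hk] using h.angle_le k
  refine ⟨fun k => (Pi.mulSingle j α : Fin r → ℝ) k • p k,
    fun k => (Pi.mulSingle j β : Fin r → ℝ) k • q k, ⟨?_, ?_, ?_, ?_, ?_, ?_, ?_⟩, hang, ?_⟩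
  · exact fun k => smul_ne_zero (hne hα k) (h.orthonormal_left.ne_zero k)
  · exact fun k => smul_ne_zero (hne hβ k) (h.orthonormal_right.ne_zero k)
  · intro k l hkl
    simp [inner_smul_left, inner_smul_right, h.orthonormal_left.inner_eq_zero hkl]
  · intro k l hkl
    simp [inner_smul_left, inner_smul_right, h.orthonormal_right.inner_eq_zero hkl]
  · intro k l hkl
    simp [inner_smul_left, inner_smul_right, h.orthogonal_pairs k l hkl]
  · rw [geomProd_smul, Finset.prod_pi_mulSingle', if_pos (Finset.mem_univ j)]
  · rw [geomProd_smul, Finset.prod_pi_mulSingle', if_pos (Finset.mem_univ j)]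
  · intro h0 k
    rcases eq_or_ne k j with rfl | hk
    · apply angle_le_pi_div_two_of_inner_nonneg
      simpa [inner_smul_left, inner_smul_right, mul_assoc, mul_left_comm] using h0
    · exact hang k hk

end IsPrincipalVectors

theorem exists_isPrincipalReshaping {A B : Cl n} (hr : 1 ≤ r) (hA : IsBlade r A)
    (hB : IsBlade r B) :
    ∃ a b : Fin r → Vec n, IsPrincipalReshaping A B a b ∧
      (∀ k : Fin r, (k : ℕ) ≠ 0 → InnerProductGeometry.angle (a k) (b k) ≤ Real.pi / 2) ∧
      (0 ≤ scalarPart (A * reverse B) →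
        ∀ k : Fin r, InnerProductGeometry.angle (a k) (b k) ≤ Real.pi / 2) := by
  obtain ⟨p, q, h⟩ := exists_isPrincipalVectors hA.finrank_bladeSpace hB.finrank_bladeSpace
  obtain ⟨α, hα, rfl⟩ := hA.exists_eq_smul_geomProd h.orthonormal_left h.span_left
  obtain ⟨β, hβ, rfl⟩ := hB.exists_eq_smul_geomProd h.orthonormal_right h.span_right
  have hs : scalarPart ((α • geomProd p) * reverse (β • geomProd q)) =
      α * β * ∏ k, cosAngle (p k) (q k) := by
    rw [map_smul, smul_mul_smul_comm, scalarPart_smul,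
      h.isPrincipalReshaping.scalarPart_mul_reverse,
      modulus_geomProd_of_orthonormal h.orthonormal_left,
      modulus_geomProd_of_orthonormal h.orthonormal_right, one_mul, one_mul]
  rw [hs]
  -- A zero scalar part says nothing about the sign of `αβ`. In that case the scalars go to a
  -- perpendicular pair, whose angle stays `π / 2` for either sign. Otherwise they go to the first
  -- pair, and a nonnegative scalar part forces `0 ≤ αβ`.
  by_cases hj : ∃ j, cosAngle (p j) (q j) = 0
  · obtain ⟨j, hj⟩ := hj
    obtain ⟨a, b, hab, -, hle⟩ := h.reshape hα hβ j
    have hle := hle (by rw [← h.cosAngle_eq_inner, hj, mul_zero])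
    exact ⟨a, b, hab, fun k _ => hle k, fun _ => hle⟩
  · push Not at hj
    obtain ⟨a, b, hab, hne, hle⟩ := h.reshape hα hβ ⟨0, hr⟩
    refine ⟨a, b, hab, fun k hk => hne k fun h0 => hk (by rw [h0]), fun h0 => hle ?_⟩
    have hpos : 0 < ∏ k, cosAngle (p k) (q k) :=
      Finset.prod_pos fun k _ => lt_of_le_of_ne (h.cosAngle_nonneg k) (hj k).symm
    rw [← h.cosAngle_eq_inner]
    exact mul_nonneg (nonneg_of_mul_nonneg_left h0 hpos) (h.cosAngle_nonneg _)

/-- With `A = α • geomProd p` and `B = β • geomProd q`, the moduli are `|α|` and `|β|`, so `ε` is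
the sign of `αβ`. -/
theorem IsPrincipalVectors.mul_reverse_eq {A B : Cl n} (hA : IsBlade r A) (hB : IsBlade r B)
    {p q : Fin r → Vec n} (h : IsPrincipalVectors (bladeSpace A) (bladeSpace B) p q) :
    ∃ ε : ℝ, (ε = 1 ∨ ε = -1) ∧ 0 < modulus A * modulus B ∧
      A * reverse B = (ε * (modulus A * modulus B)) • (geomProd p * reverse (geomProd q)) := by
  obtain ⟨α, hα, hA'⟩ := hA.exists_eq_smul_geomProd h.orthonormal_left h.span_left
  obtain ⟨β, hβ, hB'⟩ := hB.exists_eq_smul_geomProd h.orthonormal_right h.span_right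
  have hmA : modulus A = |α| := by
    rw [hA', modulus_smul, modulus_geomProd_of_orthonormal h.orthonormal_left, mul_one]
  have hmB : modulus B = |β| := by
    rw [hB', modulus_smul, modulus_geomProd_of_orthonormal h.orthonormal_right, mul_one]
  have hpos : 0 < |α * β| := abs_pos.2 (mul_ne_zero hα hβ)
  have hprod : A * reverse B = (α * β) • (geomProd p * reverse (geomProd q)) := by
    rw [hA', hB', map_smul, smul_mul_smul_comm]
  rw [hmA, hmB, ← abs_mul, hprod]
  rcases abs_choice (α * β) with hc | hc
  · exact ⟨1, Or.inl rfl, hpos, by rw [hc, one_mul]⟩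
  · exact ⟨-1, Or.inr rfl, hpos, by rw [hc, neg_one_mul, neg_neg]⟩

end SubspaceBlades

end

open SubspaceBlades in
theorem mainTheorem1 (n r : ℕ) (hr : 1 ≤ r) (A B : Cl n)
    (hA : IsBlade r A) (hB : IsBlade r B) :
    -- the blades can be reshaped into principal vectors; all angles are at most `π / 2`, except
    -- that one angle has to be obtuse if the blades are oppositely oriented
    (∃ a b : Fin r → Vec n, IsPrincipalReshaping A B a b ∧
      (∀ k : Fin r, (k : ℕ) ≠ 0 → InnerProductGeometry.angle (a k) (b k) ≤ Real.pi / 2) ∧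
      (0 ≤ scalarPart (A * CliffordAlgebra.reverse B) →
        ∀ k : Fin r, InnerProductGeometry.angle (a k) (b k) ≤ Real.pi / 2)) ∧
    -- for every such reshaping, with `c k`, `s k` and `i k` as in the next three lines
    (∀ a b : Fin r → Vec n, IsPrincipalReshaping A B a b →
      ∀ (c s : Fin r → ℝ) (i : Fin r → Cl n),
      (∀ k, c k = cosAngle (a k) (b k)) →
      (∀ k, s k = sinAngle (a k) (b k)) →
      (∀ k, i k = unitBivector (a k) (b k)) →
      -- the vectors span the represented subspaces
      Submodule.span ℝ (Set.range a) = bladeSpace A ∧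
      Submodule.span ℝ (Set.range b) = bladeSpace B ∧
      -- magnitudes
      modulus A = ∏ k, ‖a k‖ ∧ modulus B = ∏ k, ‖b k‖ ∧
      -- the `i k` are mutually orthogonal commuting unit bivectors of the planes of `a k`, `b k`
      (∀ k, s k ≠ 0 → IsBlade 2 (i k) ∧ i k * i k = -1 ∧ modulus (i k) = 1 ∧
        bladeSpace (i k) = Submodule.span ℝ {a k, b k}) ∧
      (∀ j k, j ≠ k →
        Submodule.span ℝ {a j, b j} ⟂ Submodule.span ℝ {a k, b k} ∧
        scalarPart (i j * CliffordAlgebra.reverse (i k)) = 0 ∧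
        Commute (i j) (i k)) ∧
      -- the factorization
      A * CliffordAlgebra.reverse B =
        (List.ofFn fun k => vec (a k)).prod * ((List.ofFn fun k => vec (b k)).reverse).prod ∧
      A * CliffordAlgebra.reverse B = (List.ofFn fun k => vec (a k) * vec (b k)).prod ∧
      (∀ k, vec (a k) * vec (b k) =
        (‖a k‖ * ‖b k‖) • (algebraMap ℝ (Cl n) (c k) + s k • i k)) ∧
      A * CliffordAlgebra.reverse B =
        (modulus A * modulus B) •
          (List.ofFn fun k => algebraMap ℝ (Cl n) (c k) + s k • i k).prod ∧
      -- the expansion of the rotor product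
      A * CliffordAlgebra.reverse B =
        (modulus A * modulus B) • ∑ S : Finset (Fin r),
          ((∏ k ∈ S, s k) * ∏ k ∈ Sᶜ, c k) • orderedProd S i ∧
      -- its grade parts
      (∀ m : ℕ, gradePart (2 * m) (A * CliffordAlgebra.reverse B) =
        (modulus A * modulus B) • ∑ S ∈ Finset.powersetCard m (Finset.univ : Finset (Fin r)),
          ((∏ k ∈ S, s k) * ∏ k ∈ Sᶜ, c k) • orderedProd S i) ∧
      (∀ m : ℕ, gradePart (2 * m + 1) (A * CliffordAlgebra.reverse B) = 0) ∧
      -- the scalar part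
      scalarPart (A * CliffordAlgebra.reverse B) / (modulus A * modulus B) = ∏ k, c k ∧
      -- the bivector part
      gradePart 2 (A * CliffordAlgebra.reverse B) =
        (modulus A * modulus B) • ∑ k, (s k * ∏ j ∈ Finset.univ.erase k, c j) • i k ∧
      -- the `2r`-vector part
      gradePart (2 * r) (A * CliffordAlgebra.reverse B) =
        (modulus A * modulus B * ∏ k, s k) • (List.ofFn i).prod ∧
      modulus (gradePart (2 * r) (A * CliffordAlgebra.reverse B)) =
        modulus A * modulus B * ∏ k, s k) ∧
    -- in terms of principal vectors and principal angles of the represented subspaces,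
    -- up to the sign `ε` given by the relative orientation of the blades
    (∃ p q : Fin r → Vec n, IsPrincipalVectors (bladeSpace A) (bladeSpace B) p q) ∧
    (∀ p q : Fin r → Vec n, IsPrincipalVectors (bladeSpace A) (bladeSpace B) p q →
      ∃ ε : ℝ, (ε = 1 ∨ ε = -1) ∧
        A * CliffordAlgebra.reverse B =
          (ε * (modulus A * modulus B)) • (List.ofFn fun k =>
            algebraMap ℝ (Cl n) (cosAngle (p k) (q k)) +
              sinAngle (p k) (q k) • unitBivector (p k) (q k)).prod ∧
        scalarPart (A * CliffordAlgebra.reverse B) / (modulus A * modulus B) =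
          ε * ∏ k, cosAngle (p k) (q k) ∧
        modulus (gradePart (2 * r) (A * CliffordAlgebra.reverse B)) =
          modulus A * modulus B * ∏ k, sinAngle (p k) (q k)) := by
  refine ⟨exists_isPrincipalReshaping hr hA hB, ?_,
    exists_isPrincipalVectors hA.finrank_bladeSpace hB.finrank_bladeSpace, ?_⟩
  · intro a b h c s i hc hs hi
    obtain rfl : c = fun k => cosAngle (a k) (b k) := funext hc
    obtain rfl : s = fun k => sinAngle (a k) (b k) := funext hs
    obtain rfl : i = fun k => unitBivector (a k) (b k) := funext hi
    refine ⟨?_, ?_, h.modulus_left, h.modulus_right, fun k hk => ?_, fun j k hjk =>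
      ⟨h.isOrtho_span j k hjk, h.scalarPart_mul_reverse_unitBivector j k hjk,
        h.commute_unitBivector j k hjk⟩, h.mul_reverse_eq, h.mul_reverse_eq_prod,
      fun k => vec_mul_vec (h.ne_zero_left k) (h.ne_zero_right k), h.mul_reverse_eq_rotors,
      h.mul_reverse_eq_sum, h.gradePart_even, h.gradePart_odd, ?_, h.gradePart_two,
      h.gradePart_two_mul, h.modulus_gradePart⟩
    · rw [h.eq_left, bladeSpace_geomProd h.ne_zero_left h.orthogonal_left]
    · rw [h.eq_right, bladeSpace_geomProd h.ne_zero_right h.orthogonal_right]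
    · have ha := h.ne_zero_left k
      have hb := h.ne_zero_right k
      obtain ⟨h1, h2⟩ := unitBivector_isBlade_and_bladeSpace ha hb hk
      exact ⟨h1, unitBivector_mul_self ha hb hk, modulus_unitBivector ha hb hk, h2⟩
    · rw [h.scalarPart_mul_reverse, mul_div_cancel_left₀ _ h.modulus_mul_pos.ne']
  · intro p q h
    obtain ⟨ε, hε, hpos, hAB⟩ := h.mul_reverse_eq hA hB
    have hp := modulus_geomProd_of_orthonormal h.orthonormal_left
    have hq := modulus_geomProd_of_orthonormal h.orthonormal_right
    -- Principal vectors reshape the unit blades `geomProd p` and `geomProd q`; their formulas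
    -- transfer to `A` and `B` by scaling.
    have hpq := h.isPrincipalReshaping
    refine ⟨ε, hε, ?_, ?_, ?_⟩
    · rw [hAB, hpq.mul_reverse_eq_rotors, hp, hq, one_mul, one_smul]
    · rw [hAB, scalarPart_smul, hpq.scalarPart_mul_reverse, hp, hq, one_mul, one_mul,
        mul_right_comm, mul_div_cancel_right₀ _ hpos.ne']
    · have hε' : |ε| = 1 := by rcases hε with rfl | rfl <;> simp
      rw [hAB, gradePart_smul, modulus_smul, hpq.modulus_gradePart, hp, hq, abs_mul, hε',
        abs_of_pos hpos, one_mul, one_mul, one_mul]
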